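/- Throughout, $\mathbb R^2$ carries the Euclidean metric, $\ell$ denotes the length of curves, and a domain is a nonempty connected open set. Let $A\ge 1$. A domain $\Omega\subset\mathbb R^2$ is called inner $A$-uniform if for all $a,b\in\Omega$ there is a curve $\gamma\colon[0,1]\to\Omega$ with $\gamma(0)=a$, $\gamma(1)=b$, $$\ell(\gamma)\le A\,\lambda_\Omega(a,b)\quad\text{and}\quad \min\{\ell(\gamma|_{[0,t]}),\ell(\gamma|_{[t,1]})\}\le A\,\operatorname{dist}(\gamma(t),\partial\Omega)\ \text{ for all } t\in[0,1],$$ where $\lambda_\Omega(a,b)$ is the infimum of the lengths of all curves in $\Omega$ from $a$ to $b$ (and $\operatorname{dist}(\cdot,\emptyset)=\infty$). **Theorem.** For every $A\ge 1$ there is a constant $C(A)\in(0,\infty)$ depending only on $A$ such that, for every inner $A$-uniform domain $\Omega\subset\mathbb R^2$ and every two distinct connected components $S_1,S_2$ of $\mathbb R^2\setminus\Omega$, $$\min\{\operatorname{diam}S_1,\operatorname{diam}S_2\}\le C(A)\,\operatorname{dist}(S_1,S_2),$$ where $\operatorname{dist}(S_1,S_2)=\inf\{|x-y| : x\in S_1,\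 y\in S_2\}$ and the diameter of an unbounded set is $\infty$. In particular, $\mathbb R^2\setminus\Omega$ has at most one unbounded component. -/

import Mathlib

open scoped ENNReal

/-- `γ`, restricted to `[0,1]`, is a curve in `Ω` from `a` to `b`. -/
def IsCurveIn {X : Type*} [PseudoEMetricSpace X] (Ω : Set X) (γ : ℝ → X) (a b : X) : Prop :=
  ContinuousOn γ (Set.Icc 0 1) ∧ Set.MapsTo γ (Set.Icc 0 1) Ω ∧ γ 0 = a ∧ γ 1 = b

/-- The length of the restriction of `γ` to `[s,t]`. -/
noncomputable def curveLength {X : Type*} [PseudoEMetricSpace X] (γ : ℝ → X) (s t : ℝ) : ℝ≥0∞ :=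
  eVariationOn γ (Set.Icc s t)

/-- The inner (length) metric of `Ω`: the infimum of the lengths of the curves in `Ω`
from `a` to `b`. -/
noncomputable def innerMetric {X : Type*} [PseudoEMetricSpace X] (Ω : Set X) (a b : X) : ℝ≥0∞ :=
  ⨅ (γ : ℝ → X) (_ : IsCurveIn Ω γ a b), curveLength γ 0 1

/-- `γ` is an inner `A`-uniform curve with respect to `Ω`, from `a` to `b`. The distance to the
boundary is extended-valued (it is `∞` if the boundary is empty). -/
def IsInnerUniformCurve {X : Type*} [PseudoEMetricSpace X] (A : ℝ) (Ω : Set X) (γ : ℝ → X)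
    (a b : X) : Prop :=
  IsCurveIn Ω γ a b ∧
  curveLength γ 0 1 ≤ ENNReal.ofReal A * innerMetric Ω a b ∧
  ∀ t ∈ Set.Icc (0 : ℝ) 1,
    min (curveLength γ 0 t) (curveLength γ t 1)
      ≤ ENNReal.ofReal A * Metric.infEDist (γ t) (frontier Ω)

/-- `Ω` is an inner `A`-uniform domain: a nonempty connected open set in which any two points
can be joined by an inner `A`-uniform curve. -/
def IsInnerUniformDomain {X : Type*} [PseudoEMetricSpace X] (A : ℝ) (Ω : Set X) : Prop :=
  IsOpen Ω ∧ IsConnected Ω ∧ ∀ a ∈ Ω, ∀ b ∈ Ω, ∃ γ : ℝ → X, IsInnerUniformCurve A Ω γ a b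

/-- `S` is a connected component of the set `E`. -/
def IsComponentOf {X : Type*} [TopologicalSpace X] (S E : Set X) : Prop :=
  ∃ x ∈ E, S = connectedComponentIn E x

/-- The distance between two sets. -/
noncomputable def setDist {X : Type*} [PseudoEMetricSpace X] (S T : Set X) : ℝ≥0∞ :=
  ⨅ (x ∈ S) (y ∈ T), edist x y

/-! Let x ∈ S₁, y ∈ S₂, d = |x - y|, and suppose both sets leave the disk of radius R about x, where
R is a large multiple of d. If x and y lie in different components of a compact set E, then f(z) =
(z - x)/(z - y) has no continuous logarithm off E
(`not_isLogOn_compl_of_notMem_connectedComponentIn`). So it suffices to build one for E = Ωᶜ ∩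
closedBall x R. Two partial logarithms are at hand: `farLog` where |z - x| > d, and one on each
compact subset of Ω in the R-disk, since x and y can be slid along S₁ and S₂ out of that disk
(`exists_isLogOn_sub`). Inner uniformity glues them. Near x, `farLog` is continued backwards along a
short curve escaping to distance r (`exists_escape`). Escapes of neighbouring points end at inner
close points, joined by a curve that avoids the d-disk and stays in the R-disk (`exists_avoiding`).
The loop so formed carries a single logarithm, which agrees with `farLog` on that curve up to a
constant, so the continued values fit together (`IsEscapeValue.sub_eq_sub`). -/

/-! ### Continuous logarithms. -/

/-- `M` is a continuous logarithm of `f` on `K`. -/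
def IsLogOn {X : Type*} [TopologicalSpace X] (M f : X → ℂ) (K : Set X) : Prop :=
  ContinuousOn M K ∧ ∀ z ∈ K, Complex.exp (M z) = f z

namespace IsLogOn

variable {X : Type*} [TopologicalSpace X] {M N f g : X → ℂ} {K K' : Set X}

lemma mono (h : IsLogOn M f K) (hK : K' ⊆ K) : IsLogOn M f K' :=
  ⟨h.1.mono hK, fun z hz => h.2 z (hK hz)⟩

lemma add (hM : IsLogOn M f K) (hN : IsLogOn N g K) :
    IsLogOn (fun z => M z + N z) (fun z => f z * g z) K :=
  ⟨hM.1.add hN.1, fun z hz => by rw [Complex.exp_add, hM.2 z hz, hN.2 z hz]⟩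

lemma sub (hM : IsLogOn M f K) (hN : IsLogOn N g K) :
    IsLogOn (fun z => M z - N z) (fun z => f z / g z) K :=
  ⟨hM.1.sub hN.1, fun z hz => by rw [Complex.exp_sub, hM.2 z hz, hN.2 z hz]⟩

lemma congr (hM : IsLogOn M f K) (h : ∀ z ∈ K, f z = g z) : IsLogOn M g K :=
  ⟨hM.1, fun z hz => (hM.2 z hz).trans (h z hz)⟩

/-- Two continuous logarithms on a connected set differ by a constant. -/
lemma sub_eq_sub (hM : IsLogOn M f K) (hN : IsLogOn N f K) (hK : IsPreconnected K)
    {a b : X} (ha : a ∈ K) (hb : b ∈ K) : M b - M a = N b - N a := by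
  -- The difference divided by 2πi is integer valued; its real part maps into a discrete subset of
  -- ℝ.
  have hmaps : Set.MapsTo (fun z => ((M z - N z) / (2 * Real.pi * Complex.I)).re) K
      (Set.range ((↑) : ℤ → ℝ)) := by
    intro z hz
    obtain ⟨n, hn⟩ := Complex.exp_eq_exp_iff_exists_int.1 ((hM.2 z hz).trans (hN.2 z hz).symm)
    refine ⟨n, ?_⟩
    have : (M z - N z) / (2 * Real.pi * Complex.I) = n := by
      rw [hn, add_sub_cancel_left, mul_div_cancel_right₀ _ Complex.two_pi_I_ne_zero]
    simp only [this, Complex.intCast_re]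
  have hdisc : IsDiscrete (Set.range ((↑) : ℤ → ℝ)) :=
    Int.isClosedEmbedding_coe_real.isInducing.isDiscrete_range
  have hcont : ContinuousOn (fun z => ((M z - N z) / (2 * Real.pi * Complex.I)).re) K :=
    Complex.continuous_re.comp_continuousOn ((hM.1.sub hN.1).div_const _)
  have key := hK.constant_of_mapsTo hdisc hcont hmaps ha hb
  obtain ⟨n, hn⟩ := Complex.exp_eq_exp_iff_exists_int.1 ((hM.2 a ha).trans (hN.2 a ha).symm)
  obtain ⟨m, hm⟩ := Complex.exp_eq_exp_iff_exists_int.1 ((hM.2 b hb).trans (hN.2 b hb).symm)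
  simp only [hn, hm, add_sub_cancel_left, mul_div_cancel_right₀ _ Complex.two_pi_I_ne_zero,
    Complex.intCast_re] at key
  rw [hm, hn, Int.cast_injective key]
  ring

end IsLogOn

/-- The principal logarithm of `1 + u` is continuous where `‖u‖ < 1`. -/
lemma isLogOn_log_one_add {X : Type*} [TopologicalSpace X] {u : X → ℂ} {K : Set X}
    (hu : ContinuousOn u K) (h : ∀ z ∈ K, ‖u z‖ < 1) :
    IsLogOn (fun z => Complex.log (1 + u z)) (fun z => 1 + u z) K :=
  ⟨(continuousOn_const.add hu).clog fun z hz => Complex.mem_slitPlane_of_norm_lt_one (h z hz),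
    fun z hz => Complex.exp_log
      (Complex.slitPlane_ne_zero (Complex.mem_slitPlane_of_norm_lt_one (h z hz)))⟩

lemma isLogOn_const {X : Type*} [TopologicalSpace X] {c : ℂ} (hc : c ≠ 0) (K : Set X) :
    IsLogOn (fun _ => Complex.log c) (fun _ => c) K :=
  ⟨continuousOn_const, fun _ _ => Complex.exp_log hc⟩

/-- A continuous function has a continuous logarithm near a point where it does not vanish. -/
lemma exists_isLogOn_ball {f : ℂ → ℂ} {w : ℂ} {U : Set ℂ} (hU : IsOpen U) (hw : w ∈ U)
    (hf : ContinuousOn f U) (h0 : f w ≠ 0) :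
    ∃ ε > 0, Metric.ball w ε ⊆ U ∧ ∃ N, IsLogOn N f (Metric.ball w ε) := by
  have hcont : ContinuousOn (fun z => f z / f w - 1) U := (hf.div_const _).sub continuousOn_const
  have hev : ∀ᶠ z in nhds w, z ∈ U ∧ ‖f z / f w - 1‖ < 1 := by
    have h1 : ContinuousAt (fun z => ‖f z / f w - 1‖) w :=
      (hcont.continuousAt (hU.mem_nhds hw)).norm
    refine (hU.eventually_mem hw).and (h1.eventually_lt_const ?_)
    simp [div_self h0]
  obtain ⟨ε, hε, hball⟩ := Metric.eventually_nhds_iff_ball.1 hev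
  refine ⟨ε, hε, fun z hz => (hball z hz).1, _,
    ((isLogOn_log_one_add (hcont.mono fun z hz => (hball z hz).1)
      fun z hz => (hball z hz).2).add (isLogOn_const h0 _)).congr fun z _ => ?_⟩
  field_simp
  ring

/-- If a connected set `S` contains `x` and a point outside the disk, and `K` is a compact subset
of the disk with positive distance to `S`, then `z - x` has a continuous logarithm on `K`. -/
lemma exists_isLogOn_sub {S K U : Set ℂ} {c x p : ℂ} {R : ℝ} (hS : IsPreconnected S)
    (hx : x ∈ S) (hp : p ∈ S) (hpR : R < dist p c) (hK : IsCompact K)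
    (hKR : K ⊆ Metric.closedBall c R) (hU : IsOpen U) (hKU : K ⊆ U) (hSU : S ⊆ Uᶜ) :
    ∃ M, IsLogOn M (fun z => z - x) K := by
  obtain ⟨ε, hε, hεU⟩ := hK.exists_thickening_subset_open hU hKU
  have hfar : ∀ z ∈ K, ∀ a ∈ S, ε ≤ ‖z - a‖ := by
    intro z hz a ha
    by_contra! hlt
    refine hSU ha (hεU (Metric.mem_thickening_iff.2 ⟨z, hz, ?_⟩))
    rwa [dist_comm, dist_eq_norm]
  -- z - b = (z - a)(1 + (a - b)/(z - a)), and |a - b| < ε ≤ |z - a|.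
  have step : ∀ a ∈ S, ∀ b ∈ S, dist a b < ε → (∃ M, IsLogOn M (fun z => z - a) K) →
      ∃ M, IsLogOn M (fun z => z - b) K := by
    rintro a ha b hb hab ⟨M, hM⟩
    have hne : ∀ z ∈ K, z - a ≠ 0 := fun z hz =>
      norm_pos_iff.1 (hε.trans_le (hfar z hz a ha))
    have hc : ContinuousOn (fun z => (a - b) / (z - a)) K :=
      continuousOn_const.div (continuousOn_id.sub continuousOn_const) hne
    refine ⟨_, (hM.add (isLogOn_log_one_add hc fun z hz => ?_)).congr fun z hz => ?_⟩
    · rw [norm_div, div_lt_one (hε.trans_le (hfar z hz a ha)), ← dist_eq_norm]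
      exact hab.trans_le (hfar z hz a ha)
    · have := hne z hz
      field_simp
      ring
  have base : ∃ M, IsLogOn M (fun z => z - p) K := by
    -- p = c forces R < 0, and then the disk is empty.
    have hne : c - p ≠ 0 ∨ K = ∅ := by
      by_contra! h
      obtain ⟨z, hz⟩ := h.2
      have h1 := dist_nonneg.trans (Metric.mem_closedBall.1 (hKR hz))
      rw [dist_comm, dist_eq_norm, h.1, norm_zero] at hpR
      exact (h1.trans_lt hpR).false
    rcases hne with hne | rfl
    swap
    · exact ⟨0, continuousOn_empty _, by simp⟩
    have hc : ContinuousOn (fun z => (z - c) / (c - p)) K := by fun_prop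
    refine ⟨_, ((isLogOn_const hne K).add (isLogOn_log_one_add hc fun z hz => ?_)).congr
      fun z hz => ?_⟩
    · rw [norm_div, div_lt_one (norm_pos_iff.2 hne), ← dist_eq_norm, ← dist_eq_norm,
        dist_comm c p]
      exact (Metric.mem_closedBall.1 (hKR hz)).trans_lt hpR
    · field_simp
      ring
  have := hS.induction₂
    (fun a b => (∃ M, IsLogOn M (fun z => z - a) K) ↔ ∃ M, IsLogOn M (fun z => z - b) K)
    (fun a ha => by
      filter_upwards [self_mem_nhdsWithin, mem_nhdsWithin_of_mem_nhds (Metric.ball_mem_nhds a hε)]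
        with b hb hba
      exact ⟨step a ha b hb (by rwa [dist_comm]), step b hb a ha hba⟩)
    (fun _ _ _ _ _ _ h1 h2 => h1.trans h2) (fun _ _ _ _ h => h.symm) hp hx
  exact this.1 base

/-! ### Separation of planar compact sets by logarithms. -/

/-- A nowhere vanishing continuous function on the plane has a continuous logarithm. -/
lemma exists_isLogOn_univ {v : ℂ → ℂ} (hv : Continuous v) (h0 : ∀ z, v z ≠ 0) :
    ∃ m, IsLogOn m v Set.univ := by
  have hs : IsSimplyConnected (Set.univ : Set ℂ) :=
    (Homeomorph.Set.univ ℂ).symm.toHomotopyEquiv.simplyConnectedSpace_iff.1 inferInstance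
  obtain ⟨m, hm, he⟩ := Complex.exists_continuousOn_eqOn_exp_comp hs isOpen_univ hv.continuousOn
    (by rintro ⟨z, -, hz⟩; exact h0 z hz)
  exact ⟨m, hm, fun z hz => he hz⟩

/-- There is no continuous logarithm of `z - c` on a circle around `c`. -/
lemma not_isLogOn_sphere {c : ℂ} {ρ : ℝ} (hρ : 0 < ρ) (m : ℂ → ℂ) :
    ¬ IsLogOn m (fun z => z - c) (Metric.sphere c ρ) := by
  intro h
  have hmem : ∀ t : ℝ, circleMap c ρ t ∈ Metric.sphere c ρ := circleMap_mem_sphere c hρ.le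
  have h1 : IsLogOn (fun t : ℝ => m (circleMap c ρ t)) (fun t => circleMap c ρ t - c)
      Set.univ :=
    ⟨h.1.comp (continuous_circleMap c ρ).continuousOn fun t _ => hmem t,
      fun t _ => h.2 _ (hmem t)⟩
  -- This logarithm gains 2πi over one turn, whereas `m` returns to its initial value.
  have h2 : IsLogOn (fun t : ℝ => Complex.log ρ + t * Complex.I)
      (fun t => circleMap c ρ t - c) Set.univ := by
    refine ⟨by fun_prop, fun t _ => ?_⟩
    rw [Complex.exp_add, Complex.exp_log (by exact_mod_cast hρ.ne')]
    simp [circleMap]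
  have := h1.sub_eq_sub h2 isPreconnected_univ (Set.mem_univ 0) (Set.mem_univ (2 * Real.pi))
  have hper : circleMap c ρ (2 * Real.pi) = circleMap c ρ 0 := by
    simpa using periodic_circleMap c ρ 0
  simp only [hper, sub_self] at this
  have hpi := Real.pi_ne_zero
  simp [Complex.ext_iff, hpi] at this

/-- Points in different components of a compact set are separated by a partition into
closed sets. -/
lemma IsCompact.exists_isClosed_partition {X : Type*} [TopologicalSpace X] [T2Space X] {E : Set X}
    (hE : IsCompact E) {x y : X} (hx : x ∈ E) (hy : y ∈ E) (hxy : y ∉ connectedComponentIn E x) :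
    ∃ F G : Set X, IsClosed F ∧ IsClosed G ∧ Disjoint F G ∧ F ∪ G = E ∧ x ∈ F ∧ y ∈ G := by
  have : CompactSpace E := isCompact_iff_compactSpace.1 hE
  have hy' : (⟨y, hy⟩ : E) ∉ connectedComponent (⟨x, hx⟩ : E) := fun h => hxy (by
    rw [connectedComponentIn_eq_image hx]
    exact ⟨_, h, rfl⟩)
  rw [connectedComponent_eq_iInter_isClopen, Set.mem_iInter] at hy'
  push Not at hy'
  obtain ⟨⟨Z, hZ, hxZ⟩, hyZ⟩ := hy'
  have hemb := hE.isClosed.isClosedEmbedding_subtypeVal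
  refine ⟨(↑) '' Z, (↑) '' Zᶜ, hemb.isClosedMap _ hZ.1, hemb.isClosedMap _ hZ.compl.1,
    Set.disjoint_image_of_injective Subtype.val_injective disjoint_compl_right, ?_,
    ⟨_, hxZ, rfl⟩, ⟨_, hyZ, rfl⟩⟩
  rw [← Set.image_union, Set.union_compl_self, Set.image_univ, Subtype.range_coe]

/-- If `x` and `y` lie in different components of a compact set `E`, then
`(z - x) / (z - y)` has no continuous logarithm on the complement of `E`. -/
lemma not_isLogOn_compl_of_notMem_connectedComponentIn {E : Set ℂ} (hE : IsCompact E) {x y : ℂ}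
    (hx : x ∈ E) (hy : y ∈ E) (hxy : y ∉ connectedComponentIn E x) (θ : ℂ → ℂ) :
    ¬ IsLogOn θ (fun z => (z - x) / (z - y)) Eᶜ := by
  classical
  intro hθ
  obtain ⟨F, G, hF, hG, hFG, rfl, hxF, hyG⟩ := hE.exists_isClosed_partition hx hy hxy
  obtain ⟨φ, hφF, hφG, -⟩ := exists_continuous_zero_one_of_isClosed hF hG hFG
  -- The clamp makes ψ constant near F and near G, not only on them: θ is uncontrolled at E.
  obtain ⟨ψ, hψ⟩ : ∃ ψ : ℂ → ℝ, ψ = fun z => max 0 (min 1 (3 * φ z - 1)) := ⟨_, rfl⟩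
  have hψc : Continuous ψ := by rw [hψ]; fun_prop
  have hψ0 : ∀ z, φ z < 1 / 3 → ψ z = 0 := fun z hz => by
    rw [hψ]
    exact max_eq_left (min_le_of_right_le (by linarith))
  have hψ1 : ∀ z, 2 / 3 < φ z → ψ z = 1 := fun z hz => by
    simp only [hψ]
    rw [min_eq_left (by linarith)]
    simp
  have hφ0 : ∀ z ∈ F, φ z = 0 := fun z hz => hφF hz
  have hφ1 : ∀ z ∈ G, φ z = 1 := fun z hz => hφG hz
  -- v passes from z - y near F to z - x near G without vanishing, so it has a global logarithm.
  obtain ⟨v, hv⟩ : ∃ v : ℂ → ℂ, v = fun z => if z ∈ F then z - y else if z ∈ G then z - x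
      else (z - y) * Complex.exp (ψ z * θ z) := ⟨_, rfl⟩
  have hout : ∀ z ∉ F ∪ G, z - x ≠ 0 ∧ z - y ≠ 0 := fun z hz =>
    ⟨sub_ne_zero.2 fun h => hz (h ▸ Or.inl hxF), sub_ne_zero.2 fun h => hz (h ▸ Or.inr hyG)⟩
  have hvout : ∀ z ∉ F ∪ G, v z = (z - y) * Complex.exp (ψ z * θ z) := fun z hz => by
    simp only [hv, if_neg (fun h => hz (Or.inl h)), if_neg (fun h => hz (Or.inr h))]
  have hvF : ∀ z, φ z < 1 / 3 → v z = z - y := fun z hz => by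
    by_cases hzF : z ∈ F
    · simp [hv, hzF]
    have hzG : z ∉ G := fun h => by rw [hφ1 z h] at hz; norm_num at hz
    simp [hvout z (by simp [hzF, hzG]), hψ0 z hz]
  have hvG : ∀ z, 2 / 3 < φ z → v z = z - x := fun z hz => by
    have hzF : z ∉ F := fun h => by rw [hφ0 z h] at hz; norm_num at hz
    by_cases hzG : z ∈ G
    · simp [hv, hzF, hzG]
    have hzE : z ∉ F ∪ G := by simp [hzF, hzG]
    rw [hvout z hzE, hψ1 z hz, Complex.ofReal_one, one_mul, hθ.2 z hzE,
      mul_div_cancel₀ _ (hout z hzE).2]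
  have hvc : Continuous v := by
    rw [continuous_iff_continuousAt]
    intro z
    by_cases hzE : z ∈ F ∪ G
    · rcases hzE with hz | hz
      · have : ∀ᶠ w in nhds z, v w = w - y := by
          filter_upwards [φ.continuous.continuousAt.eventually_lt_const
            (show φ z < 1 / 3 by rw [hφ0 z hz]; norm_num)] with w hw using hvF w hw
        exact ContinuousAt.congr_of_eventuallyEq (by fun_prop) this
      · have : ∀ᶠ w in nhds z, v w = w - x := by
          filter_upwards [φ.continuous.continuousAt.eventually_const_lt
            (show 2 / 3 < φ z by rw [hφ1 z hz]; norm_num)] with w hw using hvG w hw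
        exact ContinuousAt.congr_of_eventuallyEq (by fun_prop) this
    · have hopen : IsOpen (F ∪ G)ᶜ := (hF.union hG).isOpen_compl
      have hθc : ContinuousAt θ z := hθ.1.continuousAt (hopen.mem_nhds hzE)
      have : ∀ᶠ w in nhds z, v w = (w - y) * Complex.exp (ψ w * θ w) := by
        filter_upwards [hopen.mem_nhds hzE] with w hw using hvout w hw
      exact ContinuousAt.congr_of_eventuallyEq (by fun_prop) this
  have hv0 : ∀ z, v z ≠ 0 := by
    intro z
    by_cases hzF : z ∈ F
    · rw [hvF z (by rw [hφ0 z hzF]; norm_num)]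
      exact sub_ne_zero.2 fun h => hFG.le_bot ⟨hzF, h ▸ hyG⟩
    by_cases hzG : z ∈ G
    · rw [hvG z (by rw [hφ1 z hzG]; norm_num)]
      exact sub_ne_zero.2 fun h => hFG.le_bot ⟨h ▸ hxF, hzG⟩
    have hzE : z ∉ F ∪ G := by simp [hzF, hzG]
    rw [hvout z hzE]
    exact mul_ne_zero (hout z hzE).2 (Complex.exp_ne_zero _)
  obtain ⟨m, hm⟩ := exists_isLogOn_univ hvc hv0
  obtain ⟨ρ, hρ, hEρ⟩ := hE.isBounded.subset_ball_lt 0 x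
  have hsph : Metric.sphere x ρ ⊆ (F ∪ G)ᶜ := fun z hz hzE =>
    (Metric.mem_ball.1 (hEρ hzE)).ne (Metric.mem_sphere.1 hz)
  -- On a circle enclosing E, v·exp(θ - ψθ) = (z - y)·exp θ = z - x.
  refine not_isLogOn_sphere (c := x) hρ (fun z => m z - ψ z * θ z + θ z) ⟨?_, fun z hz => ?_⟩
  · exact ((hm.1.mono (Set.subset_univ _)).sub
      ((Complex.continuous_ofReal.comp hψc).continuousOn.mul (hθ.1.mono hsph))).add
      (hθ.1.mono hsph)
  · have hzE := hsph hz
    rw [Complex.exp_add, Complex.exp_sub, hm.2 z trivial, hvout z hzE, hθ.2 z hzE,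
      mul_div_cancel_right₀ _ (Complex.exp_ne_zero _), mul_div_cancel₀ _ (hout z hzE).2]

/-! ### The inner metric. -/

section Curves

variable {X : Type*} [PseudoEMetricSpace X] {Ω : Set X} {a b : X} {γ : ℝ → X}

lemma edist_le_curveLength {s t u : ℝ} (hst : s ≤ u) (hu : u ≤ t) :
    edist (γ s) (γ u) ≤ curveLength γ s t :=
  eVariationOn.edist_le γ ⟨le_rfl, hst.trans hu⟩ ⟨hst, hu⟩

lemma innerMetric_le (h : IsCurveIn Ω γ a b) : innerMetric Ω a b ≤ curveLength γ 0 1 :=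
  iInf₂_le γ h

/-- The inner metric is bounded by the length of a curve parametrized by any interval. -/
lemma innerMetric_le_curveLength {s t : ℝ} (hst : s ≤ t) (hc : ContinuousOn γ (Set.Icc s t))
    (hm : Set.MapsTo γ (Set.Icc s t) Ω) : innerMetric Ω (γ s) (γ t) ≤ curveLength γ s t := by
  have hmaps : Set.MapsTo (fun u : ℝ => s + u * (t - s)) (Set.Icc 0 1) (Set.Icc s t) := by
    rintro u ⟨h0, h1⟩
    constructor <;> nlinarith
  have hmono : MonotoneOn (fun u : ℝ => s + u * (t - s)) (Set.Icc 0 1) := fun u _ v _ huv => by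
    have := mul_le_mul_of_nonneg_right huv (sub_nonneg.2 hst)
    simpa using this
  refine (innerMetric_le (γ := γ ∘ fun u : ℝ => s + u * (t - s)) ⟨?_, ?_, ?_, ?_⟩).trans
    (eVariationOn.comp_le_of_monotoneOn γ _ hmono hmaps)
  · exact hc.comp (by fun_prop) hmaps
  · exact hm.comp hmaps
  · simp
  · simp

lemma innerMetric_comm (Ω : Set X) (a b : X) : innerMetric Ω a b = innerMetric Ω b a := by
  have key : ∀ a b : X, innerMetric Ω a b ≤ innerMetric Ω b a := by
    refine fun a b => le_iInf₂ fun γ hγ => ?_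
    have hmaps : Set.MapsTo (fun u : ℝ => 1 - u) (Set.Icc 0 1) (Set.Icc 0 1) := by
      rintro u ⟨h0, h1⟩
      constructor <;> linarith
    refine (innerMetric_le (γ := γ ∘ fun u : ℝ => 1 - u) ⟨?_, ?_, ?_, ?_⟩).trans
      (eVariationOn.comp_le_of_antitoneOn γ _ (fun u _ v _ huv => sub_le_sub_left huv 1) hmaps)
    · exact hγ.1.comp (by fun_prop) hmaps
    · exact hγ.2.1.comp hmaps
    · simpa using hγ.2.2.2
    · simpa using hγ.2.2.1
  exact le_antisymm (key a b) (key b a)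

lemma innerMetric_triangle (Ω : Set X) (a b c : X) :
    innerMetric Ω a c ≤ innerMetric Ω a b + innerMetric Ω b c := by
  simp only [innerMetric, ENNReal.iInf_add, ENNReal.add_iInf]
  refine le_iInf fun δ => le_iInf fun hδ => le_iInf fun γ => le_iInf fun hγ => ?_
  obtain ⟨η, hη⟩ : ∃ η : ℝ → X, η = fun t => if t ≤ 1 then γ t else δ (t - 1) := ⟨_, rfl⟩
  have hη1 : Set.EqOn η γ (Set.Icc 0 1) := fun t ht => by simp [hη, ht.2]
  have hη2 : Set.EqOn η (δ ∘ fun t => t - 1) (Set.Icc 1 2) := fun t ht => by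
    rcases ht.1.eq_or_lt with rfl | h
    · simp [hη, hγ.2.2.2, hδ.2.2.1]
    · simp [hη, h.not_ge]
  have hmaps : Set.MapsTo (fun t : ℝ => t - 1) (Set.Icc 1 2) (Set.Icc 0 1) := by
    rintro u ⟨h0, h1⟩
    constructor <;> linarith
  have hunion : Set.Icc (0 : ℝ) 2 = Set.Icc 0 1 ∪ Set.Icc 1 2 :=
    (Set.Icc_union_Icc_eq_Icc zero_le_one one_le_two).symm
  have h0 : η 0 = a := by rw [hη1 ⟨le_rfl, zero_le_one⟩, hγ.2.2.1]
  have h2 : η 2 = c := by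
    rw [hη2 ⟨one_le_two, le_rfl⟩, ← hδ.2.2.2]
    norm_num
  have hle := innerMetric_le_curveLength (Ω := Ω) (γ := η) (s := 0) (t := 2) zero_le_two
    (by
      rw [hunion]
      exact (hγ.1.congr hη1).union_of_isClosed ((hδ.1.comp (by fun_prop) hmaps).congr hη2)
        isClosed_Icc isClosed_Icc)
    (by
      rw [hunion]
      exact (hγ.2.1.congr hη1.symm).union (((hδ.2.1).comp hmaps).congr hη2.symm))
  rw [h0, h2] at hle
  refine hle.trans ?_
  rw [curveLength, ← Set.univ_inter (Set.Icc (0 : ℝ) 2),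
    ← eVariationOn.Icc_add_Icc η zero_le_one one_le_two (Set.mem_univ _)]
  simp only [Set.univ_inter]
  rw [eVariationOn.congr hη1, eVariationOn.congr hη2]
  exact add_le_add le_rfl
    (eVariationOn.comp_le_of_monotoneOn δ _ (fun u _ v _ huv => by simpa using huv) hmaps)

lemma innerMetric_self (h : a ∈ Ω) : innerMetric Ω a a = 0 := by
  refine le_antisymm ((innerMetric_le (γ := fun _ => a)
    ⟨continuousOn_const, fun _ _ => h, rfl, rfl⟩).trans ?_) zero_le
  exact (eVariationOn.constant_on (by
    rintro _ ⟨_, -, rfl⟩ _ ⟨_, -, rfl⟩; rfl)).le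

end Curves

/-! ### Escaping from and avoiding a boundary point. -/

section Normed

variable {E : Type*} [NormedAddCommGroup E] [NormedSpace ℝ E]

lemma innerMetric_le_edist_of_segment_subset {Ω : Set E} {a b : E} (h : segment ℝ a b ⊆ Ω) :
    innerMetric Ω a b ≤ edist a b := by
  have hmaps : Set.MapsTo (AffineMap.lineMap a b : ℝ → E) (Set.Icc 0 1) Ω := fun t ht =>
    h (segment_eq_image_lineMap ℝ a b ▸ Set.mem_image_of_mem _ ht)
  refine (innerMetric_le (γ := AffineMap.lineMap a b)
    ⟨AffineMap.lineMap_continuous.continuousOn, hmaps, by simp, by simp⟩).trans ?_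
  have hlip := (lipschitzWith_lineMap (𝕜 := ℝ) a b).lipschitzOnWith (s := Set.univ)
  have := hlip.comp_eVariationOn_le (g := id) (s := Set.Icc (0 : ℝ) 1) (Set.mapsTo_univ _ _)
  refine this.trans ?_
  rw [edist_nndist]
  simp

/-- A point of a set is at least as close to the frontier as to any point off the set. -/
lemma infEDist_frontier_le_edist {Ω : Set E} {z x : E} (hz : z ∈ Ω) (hx : x ∉ Ω) (hΩ : IsOpen Ω) :
    Metric.infEDist z (frontier Ω) ≤ edist z x := by
  obtain ⟨w, hw, hwf⟩ : ∃ w ∈ segment ℝ z x, w ∈ frontier Ω := by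
    by_contra! h
    have := (convex_segment z x).isPreconnected.subset_of_closure_inter_subset hΩ
      ⟨z, left_mem_segment ℝ z x, hz⟩ fun w hw => by
        by_contra hwΩ
        exact h w hw.2 (hΩ.frontier_eq ▸ ⟨hw.1, hwΩ⟩)
    exact hx (this (right_mem_segment ℝ z x))
  refine (Metric.infEDist_le_edist_of_mem hwf).trans ?_
  rw [edist_dist, edist_dist]
  refine ENNReal.ofReal_le_ofReal ?_
  have := dist_add_dist_of_mem_segment hw
  linarith [dist_nonneg (x := w) (y := x)]

/-- In an inner uniform domain that contains a point `p` far from a point `x ∉ Ω`, each point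
near `x` can be joined to distance `r` from `x` by a connected set that stays in the disk, with
control of the inner distance. -/
lemma IsInnerUniformDomain.exists_escape {A : ℝ} (hA : 0 ≤ A) {Ω : Set E}
    (hΩ : IsInnerUniformDomain A Ω) {x p w : E} {r : ℝ} (hr : 0 ≤ r) (hx : x ∉ Ω) (hp : p ∈ Ω)
    (hpx : (A + 1) * r < dist p x) (hw : w ∈ Ω) (hwx : dist w x ≤ r) :
    ∃ K e, IsCompact K ∧ IsPreconnected K ∧ K ⊆ Ω ∩ Metric.closedBall x r ∧ w ∈ K ∧ e ∈ K ∧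
      r ≤ dist e x ∧ innerMetric Ω w e ≤ ENNReal.ofReal (A * r) := by
  obtain ⟨γ, ⟨hc, hm, h0, h1⟩, -, hdist⟩ := hΩ.2.2 w hw p hp
  have hdc : ContinuousOn (fun t => dist (γ t) x) (Set.Icc 0 1) :=
    continuous_dist.comp_continuousOn (ContinuousOn.prodMk hc continuousOn_const)
  obtain ⟨T, hT⟩ : ∃ T, T = {t ∈ Set.Icc (0 : ℝ) 1 | r ≤ dist (γ t) x} := ⟨_, rfl⟩
  have hTcl : IsClosed T := by
    have := hdc.preimage_isClosed_of_isClosed isClosed_Icc (isClosed_Ici (a := r))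
    rw [hT]
    exact this
  have hTc : IsCompact T := isCompact_Icc.of_isClosed_subset hTcl (by rw [hT]; exact fun t ht => ht.1)
  have hTne : T.Nonempty := by
    refine ⟨1, hT ▸ ⟨⟨zero_le_one, le_rfl⟩, ?_⟩⟩
    rw [h1]
    nlinarith
  -- t is the first time at which the curve reaches distance r.
  obtain ⟨t, htT, hmin⟩ := hTc.exists_isLeast hTne
  rw [hT] at htT
  obtain ⟨⟨ht0, ht1⟩, htr⟩ := htT
  have hbefore : ∀ s ∈ Set.Ico 0 t, dist (γ s) x < r := by
    intro s hs
    by_contra! h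
    exact hs.2.not_ge (hmin (hT ▸ ⟨⟨hs.1, hs.2.le.trans ht1⟩, h⟩))
  have hle : ∀ s ∈ Set.Icc 0 t, dist (γ s) x ≤ r := by
    intro s hs
    rcases hs.1.eq_or_lt with rfl | hs0
    · rwa [h0]
    have ht0' : (0 : ℝ) < t := hs0.trans_le hs.2
    have hcl : closure (Set.Ico 0 t) = Set.Icc 0 t := closure_Ico ht0'.ne
    have hcont : ContinuousOn (fun t => dist (γ t) x) (closure (Set.Ico 0 t)) := by
      rw [hcl]
      exact hdc.mono (Set.Icc_subset_Icc_right ht1)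
    exact le_on_closure (fun s hs => (hbefore s hs).le) hcont continuousOn_const (hcl ▸ hs)
  have hsub : Set.Icc 0 t ⊆ Set.Icc 0 1 := Set.Icc_subset_Icc_right ht1
  refine ⟨γ '' Set.Icc 0 t, γ t, isCompact_Icc.image_of_continuousOn (hc.mono hsub),
    isPreconnected_Icc.image _ (hc.mono hsub), ?_, ⟨0, ⟨le_rfl, ht0⟩, h0⟩, ⟨t, ⟨ht0, le_rfl⟩, rfl⟩,
    htr, ?_⟩
  · rintro _ ⟨s, hs, rfl⟩
    exact ⟨hm (hsub hs), hle s hs⟩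
  · have hlen : innerMetric Ω (γ 0) (γ t) ≤ curveLength γ 0 t :=
      innerMetric_le_curveLength ht0 (hc.mono hsub) (hm.mono_left hsub)
    rw [← h0]
    refine hlen.trans ?_
    have hmin := hdist t ⟨ht0, ht1⟩
    have hub : ENNReal.ofReal A * Metric.infEDist (γ t) (frontier Ω) ≤ ENNReal.ofReal (A * r) := by
      rw [ENNReal.ofReal_mul hA]
      gcongr
      refine (infEDist_frontier_le_edist (hm ⟨ht0, ht1⟩) hx hΩ.1).trans ?_
      rw [edist_dist]
      exact ENNReal.ofReal_le_ofReal (hle t ⟨ht0, le_rfl⟩)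
    -- If the final piece were the short one, p would lie within (A + 1) r of x.
    rcases min_le_iff.1 (hmin.trans hub) with h | h
    · exact h
    · have h2 := (edist_le_curveLength (γ := γ) ht1 le_rfl).trans h
      rw [edist_dist, ENNReal.ofReal_le_ofReal_iff (by positivity), h1] at h2
      have := dist_triangle p (γ t) x
      rw [dist_comm p (γ t)] at this
      have := hle t ⟨ht0, le_rfl⟩
      linarith

end Normed

/-- An inner uniform curve joining two points that are inner close but far from `x ∉ Ω` avoids
a neighbourhood of `x`. -/
lemma IsInnerUniformDomain.exists_avoiding {E : Type*} [NormedAddCommGroup E] [NormedSpace ℝ E]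
    {A : ℝ} (hA : 0 ≤ A) {Ω : Set E} (hΩ : IsInnerUniformDomain A Ω) {x e e' : E} {d r l : ℝ}
    (hd : 0 ≤ d) (hdr : (A + 1) * d < r) (hl : 0 ≤ l) (hx : x ∉ Ω) (he : e ∈ Ω) (he' : e' ∈ Ω)
    (her : r ≤ dist e x) (her' : r ≤ dist e' x) (hel : innerMetric Ω e e' ≤ ENNReal.ofReal l) :
    ∃ K, IsCompact K ∧ IsPreconnected K ∧ K ⊆ Ω ∧ e ∈ K ∧ e' ∈ K ∧
      ∀ z ∈ K, d < dist z x ∧ dist z e ≤ A * l := by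
  obtain ⟨γ, ⟨hc, hm, h0, h1⟩, hlen, hdist⟩ := hΩ.2.2 e he e' he'
  refine ⟨γ '' Set.Icc 0 1, isCompact_Icc.image_of_continuousOn hc, isPreconnected_Icc.image _ hc,
    hm.image_subset, ⟨0, ⟨le_rfl, zero_le_one⟩, h0⟩, ⟨1, ⟨zero_le_one, le_rfl⟩, h1⟩, ?_⟩
  rintro _ ⟨t, ht, rfl⟩
  constructor
  · by_contra! hzd
    have hub : ENNReal.ofReal A * Metric.infEDist (γ t) (frontier Ω) ≤ ENNReal.ofReal (A * d) := by
      rw [ENNReal.ofReal_mul hA]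
      gcongr
      refine (infEDist_frontier_le_edist (hm ht) hx hΩ.1).trans ?_
      rw [edist_dist]
      exact ENNReal.ofReal_le_ofReal hzd
    -- Either way an endpoint would lie within (A + 1) d < r of x.
    rcases min_le_iff.1 ((hdist t ht).trans hub) with h | h
    · have h2 := (edist_le_curveLength (γ := γ) ht.1 le_rfl).trans h
      rw [edist_dist, ENNReal.ofReal_le_ofReal_iff (by positivity), h0] at h2
      have := dist_triangle e (γ t) x
      linarith
    · have h2 := (edist_le_curveLength (γ := γ) ht.2 le_rfl).trans h
      rw [edist_dist, ENNReal.ofReal_le_ofReal_iff (by positivity), h1, dist_comm] at h2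
      have := dist_triangle e' (γ t) x
      linarith
  · have h2 := (edist_le_curveLength (γ := γ) ht.1 ht.2).trans
      (hlen.trans (mul_le_mul_right hel _))
    rw [edist_dist, ← ENNReal.ofReal_mul hA, ENNReal.ofReal_le_ofReal_iff (by positivity), h0,
      dist_comm] at h2
    exact h2

/-! ### Gluing the logarithms. -/

/-- The logarithm of `(z - x) / (z - y)` that tends to zero at infinity. -/
noncomputable def farLog (x y z : ℂ) : ℂ := -Complex.log (1 + (x - y) / (z - x))

lemma isLogOn_farLog (x y : ℂ) :
    IsLogOn (farLog x y) (fun z => (z - x) / (z - y)) {z | dist x y < dist z x} := by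
  have hne : ∀ z ∈ {z : ℂ | dist x y < dist z x}, z - x ≠ 0 := fun z hz => by
    rw [← norm_pos_iff, ← dist_eq_norm]
    exact dist_nonneg.trans_lt hz
  have hc : ContinuousOn (fun z => (x - y) / (z - x)) {z | dist x y < dist z x} :=
    continuousOn_const.div (continuousOn_id.sub continuousOn_const) hne
  have h := isLogOn_log_one_add hc fun z hz => by
    rw [norm_div, div_lt_one (norm_pos_iff.2 (hne z hz)), ← dist_eq_norm, ← dist_eq_norm]
    exact hz
  refine ⟨h.1.neg, fun z hz => ?_⟩
  rw [farLog, Complex.exp_neg, h.2 z hz]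
  beta_reduce
  rw [one_add_div (hne z hz), inv_div, sub_add_sub_cancel]

/-- `T` is the value at `w` of the continuation, along a short escape from `x`, of the logarithm of
`(z - x) / (z - y)` at infinity. -/
def IsEscapeValue (A : ℝ) (Ω : Set ℂ) (x y : ℂ) (r : ℝ) (w T : ℂ) : Prop :=
  ∃ (K : Set ℂ) (e : ℂ) (M : ℂ → ℂ), IsCompact K ∧ IsPreconnected K ∧
    K ⊆ Ω ∩ Metric.closedBall x (2 * r) ∧ w ∈ K ∧ e ∈ K ∧ r ≤ dist e x ∧
    innerMetric Ω w e ≤ ENNReal.ofReal (A * r) ∧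
    IsLogOn M (fun z => (z - x) / (z - y)) K ∧ M e = farLog x y e ∧ M w = T

/-- Escape values at nearby points are compatible. -/
lemma IsEscapeValue.sub_eq_sub {A : ℝ} (hA : 0 ≤ A) {Ω : Set ℂ} (hΩ : IsInnerUniformDomain A Ω)
    {x y : ℂ} {r R : ℝ} (hdr : (A + 1) * dist x y < r) (hR : (A * (2 * A + 1) + 3) * r ≤ R)
    (hx : x ∉ Ω) (hlog : ∀ K, IsCompact K → K ⊆ Ω ∩ Metric.closedBall x R →
      ∃ M, IsLogOn M (fun z => (z - x) / (z - y)) K)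
    {w w' T T' : ℂ} (h : IsEscapeValue A Ω x y r w T) (h' : IsEscapeValue A Ω x y r w' T')
    (hseg : segment ℝ w w' ⊆ Ω) (hww' : dist w w' ≤ r) {N : ℂ → ℂ}
    (hN : IsLogOn N (fun z => (z - x) / (z - y)) (segment ℝ w w')) :
    T' - T = N w' - N w := by
  obtain ⟨K, e, M, hK, hKp, hKs, hwK, heK, her, hwe, hM, hMe, rfl⟩ := h
  obtain ⟨K', e', M', hK', hKp', hKs', hwK', heK', her', hwe', hM', hMe', rfl⟩ := h'
  have hr : 0 ≤ r := dist_nonneg.trans hww'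
  have hl : innerMetric Ω e e' ≤ ENNReal.ofReal ((2 * A + 1) * r) := by
    calc innerMetric Ω e e' ≤ innerMetric Ω e w + (innerMetric Ω w w' + innerMetric Ω w' e') :=
          (innerMetric_triangle Ω e w e').trans (add_le_add le_rfl (innerMetric_triangle Ω w w' e'))
      _ ≤ ENNReal.ofReal (A * r) + (ENNReal.ofReal r + ENNReal.ofReal (A * r)) := by
          rw [innerMetric_comm Ω e w]
          refine add_le_add hwe (add_le_add ?_ hwe')
          refine (innerMetric_le_edist_of_segment_subset hseg).trans ?_
          rw [edist_dist]
          exact ENNReal.ofReal_le_ofReal hww'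
      _ = ENNReal.ofReal ((2 * A + 1) * r) := by
          rw [← ENNReal.ofReal_add hr (by positivity),
            ← ENNReal.ofReal_add (by positivity) (by positivity)]
          ring_nf
  obtain ⟨G, hG, hGp, hGΩ, heG, heG', hGd⟩ := hΩ.exists_avoiding hA dist_nonneg hdr
    (by positivity) hx (hKs heK).1 (hKs' heK').1 her her' hl
  have hsegc : IsCompact (segment ℝ w w') := by
    rw [segment_eq_image_lineMap]
    exact isCompact_Icc.image AffineMap.lineMap_continuous
  have hAr : 0 ≤ A * (2 * A + 1) * r := by positivity
  have h2R : Metric.closedBall x (2 * r) ⊆ Metric.closedBall x R :=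
    Metric.closedBall_subset_closedBall (by linarith)
  -- G stays within A(2A + 1) r of e, and e within 2 r of x, so the whole loop lies in the R-disk.
  obtain ⟨P, hP⟩ := hlog (K ∪ K' ∪ segment ℝ w w' ∪ G) (((hK.union hK').union hsegc).union hG) (by
    refine Set.union_subset (Set.union_subset (Set.union_subset ?_ ?_) ?_) ?_
    · exact fun z hz => ⟨(hKs hz).1, h2R (hKs hz).2⟩
    · exact fun z hz => ⟨(hKs' hz).1, h2R (hKs' hz).2⟩
    · exact fun z hz => ⟨hseg hz, (convex_closedBall x R).segment_subset (h2R (hKs hwK).2)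
        (h2R (hKs' hwK').2) hz⟩
    · intro z hz
      refine ⟨hGΩ hz, Metric.mem_closedBall.2 ?_⟩
      have h1 := Metric.mem_closedBall.1 (hKs heK).2
      have h2 := dist_triangle z e x
      have h3 := (hGd z hz).2
      linarith)
  -- Each side's increment equals that of P, and the increments of P around the loop cancel.
  have e1 := hM.sub_eq_sub (hP.mono fun z hz => Or.inl (Or.inl (Or.inl hz))) hKp heK hwK
  have e2 := hM'.sub_eq_sub (hP.mono fun z hz => Or.inl (Or.inl (Or.inr hz))) hKp' heK' hwK'
  have e3 := hN.sub_eq_sub (hP.mono fun z hz => Or.inl (Or.inr hz))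
    (convex_segment w w').isPreconnected (left_mem_segment ℝ w w') (right_mem_segment ℝ w w')
  have e4 := ((isLogOn_farLog x y).mono fun z hz => (hGd z hz).1).sub_eq_sub
    (hP.mono fun z hz => Or.inr hz) hGp heG heG'
  rw [hMe] at e1
  rw [hMe'] at e2
  linear_combination e2 - e1 + e4 - e3

/-- Two disjoint continua in the complement of an inner uniform domain, in different components,
cannot both be large compared with the distance of two of their points. -/
theorem IsInnerUniformDomain.mem_connectedComponentIn {A : ℝ} (hA : 0 ≤ A) {Ω : Set ℂ}
    (hΩ : IsInnerUniformDomain A Ω) {S₁ S₂ : Set ℂ} (hS₁ : IsPreconnected S₁)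
    (hS₂ : IsPreconnected S₂) (hS₁Ω : S₁ ⊆ Ωᶜ) (hS₂Ω : S₂ ⊆ Ωᶜ) {x y p₁ p₂ : ℂ} (hx : x ∈ S₁)
    (hy : y ∈ S₂) (hp₁ : p₁ ∈ S₁) (hp₂ : p₂ ∈ S₂) (hxy : x ≠ y) {R : ℝ}
    (hR : R = (A * (2 * A + 1) + 3) * ((A + 2) * dist x y)) (hp₁R : R < dist p₁ x)
    (hp₂R : R < dist p₂ x) : y ∈ connectedComponentIn Ωᶜ x := by
  classical
  by_contra hcomp
  have hxΩ : x ∉ Ω := hS₁Ω hx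
  have hyΩ : y ∉ Ω := hS₂Ω hy
  have hd : 0 < dist x y := dist_pos.2 hxy
  obtain ⟨r, hr⟩ : ∃ r, r = (A + 2) * dist x y := ⟨_, rfl⟩
  rw [← hr] at hR
  have hr0 : 0 < r := hr ▸ by positivity
  have hdr : (A + 1) * dist x y < r := by rw [hr]; linarith
  have hdr' : dist x y < r := by nlinarith
  have hR' : (A + 1) * r < R := by
    rw [hR]
    have : 0 ≤ A * A * r := by positivity
    nlinarith
  have h2rR : 2 * r < R := by
    rw [hR]
    have : 0 ≤ A * (2 * A + 1) * r := by positivity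
    linarith
  have hrR : r < R := by linarith
  have hlog : ∀ K, IsCompact K → K ⊆ Ω ∩ Metric.closedBall x R →
      ∃ M, IsLogOn M (fun z => (z - x) / (z - y)) K := by
    intro K hK hKs
    obtain ⟨M₁, hM₁⟩ := exists_isLogOn_sub hS₁ hx hp₁ hp₁R hK (fun z hz => (hKs hz).2) hΩ.1
      (fun z hz => (hKs hz).1) hS₁Ω
    obtain ⟨M₂, hM₂⟩ := exists_isLogOn_sub hS₂ hy hp₂ hp₂R hK (fun z hz => (hKs hz).2) hΩ.1
      (fun z hz => (hKs hz).1) hS₂Ω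
    exact ⟨_, hM₁.sub hM₂⟩
  -- Otherwise the circle of radius R misses Ω and connects S₁ to S₂ within the complement.
  obtain ⟨p, hpΩ, hpR⟩ : ∃ p ∈ Ω, (A + 1) * r < dist p x := by
    by_contra! hall
    have hsph : Metric.sphere x R ⊆ Ωᶜ := fun z hz hzΩ =>
      (hR'.trans_eq (Metric.mem_sphere.1 hz).symm).not_ge (hall z hzΩ)
    have hmeet : ∀ S : Set ℂ, IsPreconnected S → ∀ a ∈ S, ∀ b ∈ S, dist a x ≤ R → R ≤ dist b x →
        (S ∩ Metric.sphere x R).Nonempty := by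
      intro S hS a ha b hb haR hbR
      obtain ⟨z, hz, hzR⟩ := hS.intermediate_value ha hb
        (f := fun z => dist z x) (by fun_prop) ⟨haR, hbR⟩
      exact ⟨z, hz, hzR⟩
    have hsp : IsPreconnected (Metric.sphere x R) :=
      isPreconnected_sphere (by simp) x R
    have h1 := hS₁.union' (hmeet S₁ hS₁ x hx p₁ hp₁ (by simpa using (hr0.trans hrR).le) hp₁R.le) hsp
    have h2 := hS₂.union' (hmeet S₂ hS₂ y hy p₂ hp₂ (by rw [dist_comm]; linarith) hp₂R.le) hsp
    have hne : (Metric.sphere x R).Nonempty := NormedSpace.sphere_nonempty.2 (hr0.trans hrR).le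
    obtain ⟨q, hq⟩ := hne
    have h3 := h1.union q (Or.inr hq) (Or.inr hq) h2
    refine hcomp (h3.subset_connectedComponentIn (Or.inl (Or.inl hx)) ?_ (Or.inr (Or.inl hy)))
    exact Set.union_subset (Set.union_subset hS₁Ω hsph) (Set.union_subset hS₂Ω hsph)
  have hexists : ∀ w ∈ Ω, dist w x ≤ r → ∃ T, IsEscapeValue A Ω x y r w T := by
    intro w hw hwx
    obtain ⟨K, e, hK, hKp, hKs, hwK, heK, her, hwe⟩ :=
      hΩ.exists_escape hA hr0.le hxΩ hpΩ hpR hw hwx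
    obtain ⟨M, hM⟩ := hlog K hK (hKs.trans
      (Set.inter_subset_inter_right _ (Metric.closedBall_subset_closedBall hrR.le)))
    -- The added constant makes the logarithm match `farLog` at e.
    refine ⟨_, K, e, fun z => M z + (farLog x y e - M e), hK, hKp, hKs.trans
      (Set.inter_subset_inter_right _ (Metric.closedBall_subset_closedBall (by linarith))),
      hwK, heK, her, hwe, ⟨hM.1.add continuousOn_const, fun z hz => ?_⟩, by ring, rfl⟩
    have hef := (isLogOn_farLog x y).2 e (hdr'.trans_le her)
    rw [Complex.exp_add, Complex.exp_sub, hM.2 z hz, hef, hM.2 e heK, div_self, mul_one]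
    rw [← hef]
    exact Complex.exp_ne_zero _
  -- The values are chosen arbitrarily; continuity will come from their compatibility.
  choose! τ hτ using hexists
  obtain ⟨θ, hθ⟩ : ∃ θ : ℂ → ℂ, θ = fun w => if dist w x ≤ r then τ w else farLog x y w := ⟨_, rfl⟩
  have hθfar : ∀ w, r < dist w x → θ w = farLog x y w := fun w hw => by simp [hθ, hw.not_ge]
  -- For r < |w - x| ≤ 2r the trivial escape {w} shows that `farLog` values are escape values too;
  -- this handles continuity across |w - x| = r.
  have hθval : ∀ w ∈ Ω, dist w x ≤ 2 * r → IsEscapeValue A Ω x y r w (θ w) := by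
    intro w hw hw2
    by_cases hwr : dist w x ≤ r
    · simp only [hθ, if_pos hwr]
      exact hτ w hw hwr
    · push Not at hwr
      refine ⟨{w}, w, farLog x y, isCompact_singleton, isPreconnected_singleton, ?_, rfl, rfl, hwr.le,
        ?_, (isLogOn_farLog x y).mono ?_, rfl, (hθfar w hwr).symm⟩
      · rintro _ rfl
        exact ⟨hw, hw2⟩
      · rw [innerMetric_self hw]
        exact zero_le
      · rintro _ rfl
        exact hdr'.trans hwr
  obtain ⟨E, hE⟩ : ∃ E, E = Ωᶜ ∩ Metric.closedBall x R := ⟨_, rfl⟩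
  have hEc : IsCompact E := hE ▸ (isCompact_closedBall x R).inter_left hΩ.1.isClosed_compl
  have hxE : x ∈ E := hE ▸ ⟨hxΩ, Metric.mem_closedBall_self (hr0.trans hrR).le⟩
  have hyE : y ∈ E := hE ▸ ⟨hyΩ, by rw [Metric.mem_closedBall, dist_comm]; linarith⟩
  have hnear : ∀ w ∉ E, dist w x ≤ R → w ∈ Ω := fun w hw hwR => by
    by_contra h
    exact hw (hE ▸ ⟨h, hwR⟩)
  refine not_isLogOn_compl_of_notMem_connectedComponentIn hEc hxE hyE
    (fun h => hcomp (connectedComponentIn_mono x (hE ▸ Set.inter_subset_left) h)) θ ⟨?_, ?_⟩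
  · intro w hw
    refine ContinuousAt.continuousWithinAt ?_
    -- Points of Eᶜ beyond radius R need not lie in Ω, but there `farLog` alone suffices.
    by_cases hwr : r < dist w x
    · have hopen : IsOpen {z : ℂ | r < dist z x} := isOpen_lt continuous_const (by fun_prop)
      have h1 : ContinuousAt (farLog x y) w :=
        ((isLogOn_farLog x y).1.mono fun z (hz : r < dist z x) => hdr'.trans hz).continuousAt
          (hopen.mem_nhds hwr)
      exact h1.congr_of_eventuallyEq (by
        filter_upwards [hopen.mem_nhds hwr] with z hz using hθfar z hz)
    · push Not at hwr
      have hwΩ := hnear w hw (hwr.trans hrR.le)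
      have hU : IsOpen (Ω ∩ Metric.ball x (2 * r) ∩ Metric.ball w r) :=
        (hΩ.1.inter Metric.isOpen_ball).inter Metric.isOpen_ball
      have hy0 : ∀ z ∈ Ω, z - y ≠ 0 := fun z hz => sub_ne_zero.2 fun h => hyΩ (h ▸ hz)
      obtain ⟨ε, hε, hεU, N, hN⟩ := exists_isLogOn_ball (f := fun z => (z - x) / (z - y)) hU
        (w := w) ⟨⟨hwΩ, Metric.mem_ball.2 (by linarith)⟩, Metric.mem_ball_self hr0⟩
        (ContinuousOn.div (by fun_prop) (by fun_prop) fun z hz => hy0 z hz.1.1)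
        (div_ne_zero (sub_ne_zero.2 fun h => hxΩ (h ▸ hwΩ)) (hy0 w hwΩ))
      have hev : ∀ᶠ z in nhds w, θ z = θ w + (N z - N w) := by
        filter_upwards [Metric.ball_mem_nhds w hε] with z hz
        have hsegε : segment ℝ w z ⊆ Metric.ball w ε :=
          (convex_ball w ε).segment_subset (Metric.mem_ball_self hε) hz
        have hzU := hεU hz
        have := (hθval w hwΩ (by linarith)).sub_eq_sub hA hΩ hdr hR.ge hxΩ hlog
          (hθval z hzU.1.1 (Metric.mem_ball.1 hzU.1.2).le) (fun u hu => (hεU (hsegε hu)).1.1)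
          (by rw [dist_comm]; exact (Metric.mem_ball.1 hzU.2).le) (hN.mono hsegε)
        rw [← this]
        ring
      have hNc : ContinuousAt N w := hN.1.continuousAt (Metric.ball_mem_nhds w hε)
      exact ContinuousAt.congr_of_eventuallyEq (by fun_prop) hev
  · intro w hw
    by_cases hwr : r < dist w x
    · rw [hθfar w hwr]
      exact (isLogOn_farLog x y).2 w (hdr'.trans hwr)
    · push Not at hwr
      obtain ⟨K, e, M, -, -, -, hwK, -, -, -, hM, -, hMw⟩ :=
        hθval w (hnear w hw (hwr.trans hrR.le)) (by linarith)
      rw [← hMw]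
      exact hM.2 w hwK

/-! ### Invariance under isometries, to pass from the Euclidean plane to ℂ. -/

section Isometry

variable {X Y : Type*} [PseudoEMetricSpace X] [PseudoEMetricSpace Y]

lemma Isometry.curveLength_comp {f : X → Y} (hf : Isometry f) (γ : ℝ → X) (s t : ℝ) :
    curveLength (f ∘ γ) s t = curveLength γ s t := by
  simp [curveLength, eVariationOn, hf.edist_eq]

lemma IsCurveIn.comp {f : X → Y} (hf : Continuous f) {Ω : Set X} {Ω' : Set Y}
    (hΩ : Set.MapsTo f Ω Ω') {γ : ℝ → X} {a b : X} (h : IsCurveIn Ω γ a b) :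
    IsCurveIn Ω' (f ∘ γ) (f a) (f b) :=
  ⟨hf.comp_continuousOn h.1, hΩ.comp h.2.1, congrArg f h.2.2.1, congrArg f h.2.2.2⟩

lemma IsometryEquiv.innerMetric_image (Φ : X ≃ᵢ Y) (Ω : Set X) (a b : X) :
    innerMetric (Φ '' Ω) (Φ a) (Φ b) = innerMetric Ω a b := by
  refine le_antisymm (le_iInf₂ fun γ hγ => ?_) (le_iInf₂ fun γ hγ => ?_)
  · rw [← Φ.isometry.curveLength_comp]
    exact innerMetric_le (hγ.comp Φ.continuous (Set.mapsTo_image _ _))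
  · rw [← Φ.symm.isometry.curveLength_comp]
    have := hγ.comp (Ω' := Ω) Φ.symm.continuous (by rintro _ ⟨z, hz, rfl⟩; simpa using hz)
    simp only [Φ.symm_apply_apply] at this
    exact innerMetric_le this

lemma IsInnerUniformDomain.image {A : ℝ} {Ω : Set X} (hΩ : IsInnerUniformDomain A Ω)
    (Φ : X ≃ᵢ Y) : IsInnerUniformDomain A (Φ '' Ω) := by
  refine ⟨Φ.toHomeomorph.isOpenMap _ hΩ.1, hΩ.2.1.image _ Φ.continuous.continuousOn, ?_⟩
  rintro _ ⟨a, ha, rfl⟩ _ ⟨b, hb, rfl⟩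
  obtain ⟨γ, hγ, hlen, hdist⟩ := hΩ.2.2 a ha b hb
  refine ⟨Φ ∘ γ, hγ.comp Φ.continuous (Set.mapsTo_image _ _), ?_, fun t ht => ?_⟩
  · rwa [Φ.isometry.curveLength_comp, Φ.innerMetric_image]
  · have hfr : frontier (Φ '' Ω) = Φ '' frontier Ω := (Φ.toHomeomorph.image_frontier Ω).symm
    rw [Φ.isometry.curveLength_comp, Φ.isometry.curveLength_comp, hfr, Function.comp_apply,
      Metric.infEDist_image Φ.isometry]
    exact hdist t ht

end Isometry

/-! ### Conclusion. -/

/-- A set whose diameter exceeds `2 R` has a point at distance more than `R` from any point. -/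
lemma exists_lt_dist_of_lt_ediam {X : Type*} [PseudoMetricSpace X] {S : Set X} {R : ℝ}
    (h : ENNReal.ofReal (2 * R) < Metric.ediam S) (x : X) : ∃ p ∈ S, R < dist p x := by
  by_contra! hall
  refine h.not_ge (Metric.ediam_le fun p hp q hq => ?_)
  rw [edist_dist]
  refine ENNReal.ofReal_le_ofReal ?_
  linarith [dist_triangle_right p q x, hall p hp, hall q hq]

/-- Distinct components of the complement of a planar inner uniform domain are relatively
separated. -/
theorem IsInnerUniformDomain.min_ediam_le {A : ℝ} (hA : 0 ≤ A)
    {Ω : Set (EuclideanSpace ℝ (Fin 2))} (hΩ : IsInnerUniformDomain A Ω)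
    {S₁ S₂ : Set (EuclideanSpace ℝ (Fin 2))} (hS₁ : IsComponentOf S₁ Ωᶜ)
    (hS₂ : IsComponentOf S₂ Ωᶜ) (hne : S₁ ≠ S₂) :
    min (Metric.ediam S₁) (Metric.ediam S₂) ≤
      ENNReal.ofReal (2 * ((A * (2 * A + 1) + 3) * (A + 2))) * setDist S₁ S₂ := by
  obtain ⟨a, ha, rfl⟩ := hS₁
  obtain ⟨b, hb, rfl⟩ := hS₂
  by_contra! hlt
  have hC : 0 < 2 * ((A * (2 * A + 1) + 3) * (A + 2)) := by positivity
  rw [setDist] at hlt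
  simp only [ENNReal.mul_iInf_of_ne (ENNReal.ofReal_pos.2 hC).ne' ENNReal.ofReal_ne_top,
    iInf_lt_iff] at hlt
  obtain ⟨x, hx, y, hy, hlt⟩ := hlt
  have hcx := connectedComponentIn_eq hx
  have hcy := connectedComponentIn_eq hy
  have hnot : y ∉ connectedComponentIn Ωᶜ x := fun h =>
    hne (hcx.trans ((connectedComponentIn_eq h).trans hcy.symm))
  have hxy : x ≠ y := by
    rintro rfl
    exact hnot (hcx ▸ hx)
  -- The constant is 2R/|x - y|; the 2 comes from passing from diameter to distance from x.
  obtain ⟨R, hR⟩ : ∃ R, R = (A * (2 * A + 1) + 3) * ((A + 2) * dist x y) := ⟨_, rfl⟩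
  rw [edist_dist, ← ENNReal.ofReal_mul hC.le, lt_min_iff,
    show 2 * ((A * (2 * A + 1) + 3) * (A + 2)) * dist x y = 2 * R by rw [hR]; ring] at hlt
  obtain ⟨p₁, hp₁, hp₁R⟩ := exists_lt_dist_of_lt_ediam hlt.1 x
  obtain ⟨p₂, hp₂, hp₂R⟩ := exists_lt_dist_of_lt_ediam hlt.2 x
  let Φ : EuclideanSpace ℝ (Fin 2) ≃ᵢ ℂ := Complex.orthonormalBasisOneI.repr.symm.toIsometryEquiv
  have himage : ∀ z, Φ '' connectedComponentIn Ωᶜ z ⊆ (Φ '' Ω)ᶜ := fun z => by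
    rw [← Set.image_compl_eq Φ.bijective]
    exact Set.image_mono (connectedComponentIn_subset _ _)
  have key := (hΩ.image Φ).mem_connectedComponentIn (R := R) hA
    (isPreconnected_connectedComponentIn.image Φ Φ.continuous.continuousOn)
    (isPreconnected_connectedComponentIn.image Φ Φ.continuous.continuousOn)
    (himage a) (himage b) (Set.mem_image_of_mem Φ hx) (Set.mem_image_of_mem Φ hy)
    (Set.mem_image_of_mem Φ hp₁) (Set.mem_image_of_mem Φ hp₂) (Φ.injective.ne hxy)
    (by rw [Φ.dist_eq]; exact hR) (by rwa [Φ.dist_eq]) (by rwa [Φ.dist_eq])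
  have himg : Φ '' connectedComponentIn Ωᶜ x = connectedComponentIn (Φ '' Ωᶜ) (Φ x) :=
    Φ.toHomeomorph.image_connectedComponentIn (connectedComponentIn_subset _ _ hx)
  rw [← Set.image_compl_eq Φ.bijective, ← himg] at key
  exact hnot (Φ.injective.mem_set_image.1 key)

theorem theorem2p2 :
    ∀ A : ℝ, 1 ≤ A → ∃ C : ℝ, 0 < C ∧
      ∀ Ω : Set (EuclideanSpace ℝ (Fin 2)), IsInnerUniformDomain A Ω →
        (∀ S₁ S₂ : Set (EuclideanSpace ℝ (Fin 2)),
          IsComponentOf S₁ Ωᶜ → IsComponentOf S₂ Ωᶜ → S₁ ≠ S₂ →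
            min (Metric.ediam S₁) (Metric.ediam S₂) ≤ ENNReal.ofReal C * setDist S₁ S₂) ∧
        (∀ S₁ S₂ : Set (EuclideanSpace ℝ (Fin 2)),
          IsComponentOf S₁ Ωᶜ → IsComponentOf S₂ Ωᶜ →
            ¬ Bornology.IsBounded S₁ → ¬ Bornology.IsBounded S₂ → S₁ = S₂) := by
  intro A hA
  have hA0 : 0 ≤ A := zero_le_one.trans hA
  refine ⟨2 * ((A * (2 * A + 1) + 3) * (A + 2)), by positivity, fun Ω hΩ =>
    ⟨fun S₁ S₂ h₁ h₂ hne => hΩ.min_ediam_le hA0 h₁ h₂ hne, fun S₁ S₂ h₁ h₂ hb₁ hb₂ => ?_⟩⟩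
  by_contra hne
  have hle := hΩ.min_ediam_le hA0 h₁ h₂ hne
  rw [Metric.isBounded_iff_ediam_ne_top, not_not] at hb₁ hb₂
  obtain ⟨a, ha, rfl⟩ := h₁
  obtain ⟨b, hb, rfl⟩ := h₂
  -- Two unbounded components have infinite diameters but finite distance.
  have hdist : setDist (connectedComponentIn Ωᶜ a) (connectedComponentIn Ωᶜ b) ≤ edist a b :=
    iInf₂_le_of_le a (mem_connectedComponentIn ha)
      (iInf₂_le b (mem_connectedComponentIn hb))
  rw [hb₁, hb₂, min_self, top_le_iff] at hle
  exact ENNReal.mul_ne_top ENNReal.ofReal_ne_top (ne_top_of_le_ne_top (edist_ne_top a b) hdist) hle
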